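/- **Theorem 2.2.** Let $\mathbb N=\{0,1,2,\dots\}$. James' space $J$ is the real Banach space of all real sequences $x=(x_i)_{i\in\mathbb N}$ with $\lim_i x_i=0$ and finite square variation norm $$\|x\|=\sup\Bigl\{\Bigl(\sum_{j=1}^{n}|x_{p_{j+1}}-x_{p_j}|^2\Bigr)^{1/2} : n\ge 1,\ 0\le p_1<p_2<\dots<p_{n+1}\Bigr\}.$$ Let $(e_i)$ be its coordinate basis, $B_J$ its closed unit ball and $I$ its identity operator. A real Banach space $E$ has the (bounded) weakly compact approximation property (W.A.P.) with constant $C$ if for every weakly compact set $D\subset E$ and every $\varepsilon>0$ there is a weakly compact operator $V:E\to E$ (a bounded linear operator mapping the closed unit ball onto a relatively weakly compact set) with $$\sup_{x\in D}\|x-Vx\|<\varepsilon\quad\text{and}\quad\|V\|\le C;$$ $E$ has the W.A.P. if this holds for some $C<\infty$. (For $D=\emptyset$ the supremum is $0$.) Call a pair of strictly increasing sequences of integers $0=n_0<n_1<\cdots$ and $0=p_0<p_1<\cdots$ a subdivision. For each $j\in\mathbb N$ it gives the block $I_j=\{n_{p_j},\dots,n_{p_{j+1}}-1\}$, the vector $g_j=\sum_{i\in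 I_j}e_i\in J$ and the double average $$A_j(x)=\frac1{p_{j+1}-p_j}\sum_{i=p_j}^{p_{j+1}-1}\ \frac1{n_{i+1}-n_i}\sum_{s=n_i}^{n_{i+1}-1}x_s\qquad(x\in J).$$ Then the following hold. 1. $J$ has the W.A.P., and it has the W.A.P. with constant $3$. 2. For every subdivision, the formula $Vx=x-\sum_{j=0}^\infty A_j(x)g_j$ $(x\in J)$, where the partial sums of the series converge in the norm of $J$, defines a bounded linear operator $V=I-\sum_j A_j(\cdot)g_j$ on $J$, which is weakly compact and satisfies $\|V\|\le 3$. 3. For every weakly compact set $D\subset B_J$ and every $\varepsilon>0$ there is a subdivision for which the (weakly compact) operator $V$ of part 2 satisfies $\sup_{x\in D}\|x-Vx\|<\varepsilon$ (and $\|V\|\le 3$). -/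

import Mathlib

open Filter Topology

noncomputable section

/-- The sum `∑_{j=1}^n |x_{p_{j+1}} - x_{p_j}|²`.  Sequences are indexed by `ℕ = {0, 1, 2, …}`,
and so are the members `p 0 < p 1 < ⋯ < p n` of an increasing family of indices. -/
def sqVarSum (x : ℕ → ℝ) (n : ℕ) (p : ℕ → ℕ) : ℝ :=
  ∑ j ∈ Finset.range n, |x (p (j + 1)) - x (p j)| ^ 2

/-- All the sums whose supremum is the square of the square variation norm of `x`.
(A finite strictly increasing family of indices is an initial segment of an infinite one;
`n = 0` only contributes the value `0`, which does not affect the supremum.) -/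
def sqVarSet (x : ℕ → ℝ) : Set ℝ :=
  {s | ∃ (n : ℕ) (p : ℕ → ℕ), StrictMono p ∧ s = sqVarSum x n p}

/-- The square variation norm of a sequence. -/
def sqVarNorm (x : ℕ → ℝ) : ℝ := Real.sqrt (sSup (sqVarSet x))

theorem sqVarSum_nonneg (x : ℕ → ℝ) (n : ℕ) (p : ℕ → ℕ) : 0 ≤ sqVarSum x n p :=
  Finset.sum_nonneg fun _ _ => by positivity

theorem sqVarSet_nonempty (x : ℕ → ℝ) : (sqVarSet x).Nonempty :=
  ⟨_, 0, id, strictMono_id, rfl⟩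

theorem sqVarNorm_nonneg (x : ℕ → ℝ) : 0 ≤ sqVarNorm x := Real.sqrt_nonneg _

theorem sqVarSum_le {x : ℕ → ℝ} (hx : BddAbove (sqVarSet x)) (n : ℕ) {p : ℕ → ℕ}
    (hp : StrictMono p) : sqVarSum x n p ≤ sqVarNorm x ^ 2 := by
  have h : sqVarSum x n p ≤ sSup (sqVarSet x) := le_csSup hx ⟨n, p, hp, rfl⟩
  rw [sqVarNorm, Real.sq_sqrt ((sqVarSum_nonneg x n p).trans h)]
  exact h

theorem sqVarNorm_le {x : ℕ → ℝ} {c : ℝ} (hc : 0 ≤ c)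
    (h : ∀ n p, StrictMono p → sqVarSum x n p ≤ c ^ 2) :
    BddAbove (sqVarSet x) ∧ sqVarNorm x ≤ c := by
  have hb : ∀ s ∈ sqVarSet x, s ≤ c ^ 2 := by
    rintro s ⟨n, p, hp, rfl⟩
    exact h n p hp
  exact ⟨⟨_, hb⟩, Real.sqrt_le_iff.2 ⟨hc, csSup_le (sqVarSet_nonempty x) hb⟩⟩

theorem sqrt_sqVarSum_add_le (x y : ℕ → ℝ) (n : ℕ) (p : ℕ → ℕ) :
    Real.sqrt (sqVarSum (x + y) n p)
      ≤ Real.sqrt (sqVarSum x n p) + Real.sqrt (sqVarSum y n p) := by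
  have h := Real.Lp_add_le (Finset.range n) (fun j => x (p (j + 1)) - x (p j))
    (fun j => y (p (j + 1)) - y (p j)) (p := 2) (by norm_num)
  simp only [Real.rpow_two, ← Real.sqrt_eq_rpow] at h
  have e : sqVarSum (x + y) n p = ∑ j ∈ Finset.range n,
      |(x (p (j + 1)) - x (p j)) + (y (p (j + 1)) - y (p j))| ^ 2 := by
    refine Finset.sum_congr rfl fun j _ => ?_
    simp only [Pi.add_apply]
    congr 2
    ring
  rw [e]
  exact h

theorem sqVarNorm_add {x y : ℕ → ℝ} (hx : BddAbove (sqVarSet x)) (hy : BddAbove (sqVarSet y)) :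
    BddAbove (sqVarSet (x + y)) ∧ sqVarNorm (x + y) ≤ sqVarNorm x + sqVarNorm y := by
  refine sqVarNorm_le (add_nonneg (sqVarNorm_nonneg x) (sqVarNorm_nonneg y)) fun n p hp => ?_
  refine (Real.sqrt_le_left (add_nonneg (sqVarNorm_nonneg x) (sqVarNorm_nonneg y))).1 ?_
  refine (sqrt_sqVarSum_add_le x y n p).trans (add_le_add ?_ ?_)
  · exact (Real.sqrt_le_left (sqVarNorm_nonneg x)).2 (sqVarSum_le hx n hp)
  · exact (Real.sqrt_le_left (sqVarNorm_nonneg y)).2 (sqVarSum_le hy n hp)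

theorem sqVarNorm_smul (c : ℝ) {x : ℕ → ℝ} (hx : BddAbove (sqVarSet x)) :
    BddAbove (sqVarSet (c • x)) ∧ sqVarNorm (c • x) ≤ |c| * sqVarNorm x := by
  refine sqVarNorm_le (mul_nonneg (abs_nonneg c) (sqVarNorm_nonneg x)) fun n p hp => ?_
  have e : sqVarSum (c • x) n p = |c| ^ 2 * sqVarSum x n p := by
    simp only [sqVarSum, Finset.mul_sum, Pi.smul_apply, smul_eq_mul, ← mul_sub, abs_mul, mul_pow]
  rw [e, mul_pow]
  exact mul_le_mul_of_nonneg_left (sqVarSum_le hx n hp) (by positivity)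

theorem sqVarSet_zero : BddAbove (sqVarSet 0) ∧ sqVarNorm 0 ≤ 0 :=
  sqVarNorm_le le_rfl fun n p _ => by simp [sqVarSum]

/-- For a null sequence every coordinate is bounded by the square variation norm. -/
theorem abs_le_sqVarNorm {x : ℕ → ℝ} (h0 : Tendsto x atTop (𝓝 0)) (hx : BddAbove (sqVarSet x))
    (s : ℕ) : |x s| ≤ sqVarNorm x := by
  have h1 : ∀ m, s < m → |x m - x s| ≤ sqVarNorm x := by
    intro m hm
    have hp : StrictMono (fun j : ℕ => s + j * (m - s)) := by
      intro a b hab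
      have : 0 < m - s := by omega
      have := Nat.mul_lt_mul_of_pos_right hab this
      simpa using this
    have := sqVarSum_le hx 1 hp
    simp only [sqVarSum, Finset.range_one, Finset.sum_singleton, zero_add, one_mul, zero_mul,
      add_zero, Nat.add_sub_cancel' hm.le] at this
    exact le_of_sq_le_sq this (sqVarNorm_nonneg x)
  have h2 : Tendsto (fun m => |x m - x s|) atTop (𝓝 |0 - x s|) := (h0.sub_const _).abs
  have h3 := le_of_tendsto h2 ((eventually_gt_atTop s).mono h1)
  simpa using h3

/-- The linear space underlying James' space: null sequences of finite square variation. -/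
def jamesSubmodule : Submodule ℝ (ℕ → ℝ) where
  carrier := {x | Tendsto x atTop (𝓝 0) ∧ BddAbove (sqVarSet x)}
  add_mem' := fun hx hy =>
    ⟨(add_zero (0 : ℝ)) ▸ Tendsto.add hx.1 hy.1, (sqVarNorm_add hx.2 hy.2).1⟩
  zero_mem' := ⟨tendsto_const_nhds, sqVarSet_zero.1⟩
  smul_mem' := fun c _ hx =>
    ⟨(smul_zero (A := ℝ) c) ▸ Tendsto.const_smul hx.1 c, (sqVarNorm_smul c hx.2).1⟩

/-- James' space `J`.  (A type of its own, so that it carries the norm topology and not the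
topology of coordinatewise convergence.) -/
def JamesSpace : Type := jamesSubmodule

namespace JamesSpace

instance : AddCommGroup JamesSpace := inferInstanceAs (AddCommGroup jamesSubmodule)

instance : Module ℝ JamesSpace := inferInstanceAs (Module ℝ jamesSubmodule)

/-- An element of `J` viewed as a sequence of real numbers. -/
instance : CoeFun JamesSpace (fun _ => ℕ → ℝ) := ⟨fun x => Subtype.val x⟩

theorem ext {x y : JamesSpace} (h : ∀ i, x i = y i) : x = y := Subtype.ext (funext h)

theorem tendsto_zero (x : JamesSpace) : Tendsto (fun i => x i) atTop (𝓝 0) := x.2.1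

theorem bddAbove (x : JamesSpace) : BddAbove (sqVarSet (fun i => x i)) := x.2.2

@[simp] theorem add_apply (x y : JamesSpace) (i : ℕ) : (x + y) i = x i + y i := rfl

@[simp] theorem sub_apply (x y : JamesSpace) (i : ℕ) : (x - y) i = x i - y i := rfl

@[simp] theorem neg_apply (x : JamesSpace) (i : ℕ) : (-x) i = -x i := rfl

@[simp] theorem zero_apply (i : ℕ) : (0 : JamesSpace) i = 0 := rfl

@[simp] theorem smul_apply (c : ℝ) (x : JamesSpace) (i : ℕ) : (c • x) i = c * x i := rfl

/-- `J` with the square variation norm. -/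
instance : NormedAddCommGroup JamesSpace :=
  AddGroupNorm.toNormedAddCommGroup
    { toFun := fun x => sqVarNorm (fun i => x i)
      map_zero' := le_antisymm sqVarSet_zero.2 (sqVarNorm_nonneg _)
      add_le' := fun x y => (sqVarNorm_add x.bddAbove y.bddAbove).2
      neg' := fun x => by
        have e : ∀ n p, sqVarSum (fun i => (-x) i) n p = sqVarSum (fun i => x i) n p := by
          intro n p
          refine Finset.sum_congr rfl fun j _ => ?_
          simp only [neg_apply]
          rw [← abs_neg]
          congr 2
          ring
        simp only [sqVarNorm, sqVarSet, e]
      eq_zero_of_map_eq_zero' := fun x hx => ext fun i => by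
        have h := abs_le_sqVarNorm x.tendsto_zero x.bddAbove i
        rw [hx] at h
        exact abs_nonpos_iff.1 h }

theorem norm_def (x : JamesSpace) : ‖x‖ = sqVarNorm (fun i => x i) := rfl

instance : NormedSpace ℝ JamesSpace where
  norm_smul_le c x := (sqVarNorm_smul c x.bddAbove).2

theorem abs_apply_le (x : JamesSpace) (i : ℕ) : |x i| ≤ ‖x‖ :=
  abs_le_sqVarNorm x.tendsto_zero x.bddAbove i

/-- `J` is a Banach space. -/
instance : CompleteSpace JamesSpace := by
  refine Metric.complete_of_cauchySeq_tendsto fun u hu => ?_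
  have hc : ∀ i, CauchySeq fun k => u k i := by
    intro i
    rw [Metric.cauchySeq_iff'] at hu ⊢
    intro ε hε
    obtain ⟨N, hN⟩ := hu ε hε
    refine ⟨N, fun k hk => ?_⟩
    have h1 := abs_apply_le (u k - u N) i
    have h2 := hN k hk
    rw [dist_eq_norm] at h2
    rw [Real.dist_eq]
    exact h1.trans_lt h2
  choose y hy using fun i => cauchySeq_tendsto_of_complete (hc i)
  have key : ∀ ε > 0, ∃ N, ∀ k ≥ N,
      BddAbove (sqVarSet (y - fun i => u k i)) ∧ sqVarNorm (y - fun i => u k i) ≤ ε ∧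
        ∀ i, |y i - u k i| ≤ ε := by
    intro ε hε
    obtain ⟨N, hN⟩ := Metric.cauchySeq_iff.1 hu ε hε
    refine ⟨N, fun k hk => ?_⟩
    rw [← and_assoc]
    constructor
    · refine sqVarNorm_le hε.le fun n p hp => ?_
      have ht : Tendsto (fun l => sqVarSum (fun i => (u l - u k) i) n p) atTop
          (𝓝 (sqVarSum (y - fun i => u k i) n p)) := by
        refine tendsto_finsetSum _ fun j _ => ?_
        exact ((((hy _).sub_const _).sub ((hy _).sub_const _)).abs).pow 2
      refine le_of_tendsto ht ((eventually_ge_atTop N).mono fun l hl => ?_)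
      have h1 := sqVarSum_le (u l - u k).bddAbove n hp
      have h2 := hN l hl k hk
      rw [dist_eq_norm] at h2
      exact h1.trans (pow_le_pow_left₀ (sqVarNorm_nonneg _) h2.le 2)
    · intro i
      refine le_of_tendsto ((hy i).sub_const (u k i)).abs
        ((eventually_ge_atTop N).mono fun l hl => ?_)
      have h2 := hN l hl k hk
      rw [dist_eq_norm] at h2
      exact (abs_apply_le (u l - u k) i).trans h2.le
  have hy0 : Tendsto y atTop (𝓝 0) := by
    rw [Metric.tendsto_atTop]
    intro ε hε
    obtain ⟨N, hN⟩ := key (ε / 2) (half_pos hε)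
    obtain ⟨M, hM⟩ := Metric.tendsto_atTop.1 (u N).tendsto_zero (ε / 2) (half_pos hε)
    refine ⟨M, fun i hi => ?_⟩
    have h1 := (hN N le_rfl).2.2 i
    have h2 := hM i hi
    rw [Real.dist_eq, sub_zero] at h2 ⊢
    have h3 := abs_add_le (y i - u N i) (u N i)
    rw [sub_add_cancel] at h3
    linarith
  have hyb : BddAbove (sqVarSet y) := by
    obtain ⟨N, hN⟩ := key 1 one_pos
    have := (sqVarNorm_add (hN N le_rfl).1 (u N).bddAbove).1
    rwa [sub_add_cancel] at this
  have hmem : y ∈ jamesSubmodule := ⟨hy0, hyb⟩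
  let z : JamesSpace := ⟨y, hmem⟩
  refine ⟨z, Metric.tendsto_atTop.2 fun ε hε => ?_⟩
  obtain ⟨N, hN⟩ := key (ε / 2) (half_pos hε)
  refine ⟨N, fun k hk => ?_⟩
  rw [dist_comm, dist_eq_norm]
  exact ((hN k hk).2.1).trans_lt (half_lt_self hε)

theorem single_mem (i : ℕ) : (Pi.single i 1 : ℕ → ℝ) ∈ jamesSubmodule := by
  constructor
  · refine tendsto_const_nhds.congr' ?_
    filter_upwards [eventually_gt_atTop i] with k hk
    rw [Pi.single_eq_of_ne (by omega)]
  · have hs : ∀ (n : ℕ) (q : ℕ → ℕ), StrictMono q →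
        ∑ j ∈ Finset.range n, (Pi.single i 1 : ℕ → ℝ) (q j) ^ 2 ≤ 1 := by
      intro n q hq
      rw [← Finset.sum_image (f := fun k => (Pi.single i 1 : ℕ → ℝ) k ^ 2) hq.injective.injOn]
      have e : ∀ k, (Pi.single i 1 : ℕ → ℝ) k ^ 2 = if k = i then 1 else 0 := by
        intro k
        by_cases h : k = i
        · subst h
          simp
        · simp [h]
      simp only [e, Finset.sum_ite_eq']
      split_ifs <;> norm_num
    refine (sqVarNorm_le (c := 2) (by norm_num) fun n p hp => ?_).1
    have h1 := hs n p hp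
    have h2 := hs n (fun j => p (j + 1)) (fun a b hab => hp (by omega))
    have h3 : sqVarSum (Pi.single i 1) n p ≤
        ∑ j ∈ Finset.range n, (2 * (Pi.single i 1 : ℕ → ℝ) (p (j + 1)) ^ 2
          + 2 * (Pi.single i 1 : ℕ → ℝ) (p j) ^ 2) := by
      refine Finset.sum_le_sum fun j _ => ?_
      rw [sq_abs]
      nlinarith [sq_nonneg ((Pi.single i 1 : ℕ → ℝ) (p (j + 1)) + (Pi.single i 1 : ℕ → ℝ) (p j))]
    rw [Finset.sum_add_distrib, ← Finset.mul_sum, ← Finset.mul_sum] at h3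
    linarith

/-- The coordinate basis vectors `e_i` of `J`. -/
def basisVec (i : ℕ) : JamesSpace := ⟨Pi.single i 1, single_mem i⟩

/-- The average `A_{[a,b)}(x) = (b - a)⁻¹ ∑_{s=a}^{b-1} x_s` over the interval
`[a,b) = {a, …, b-1}`, for `a < b`. -/
def avg (a b : ℕ) (x : JamesSpace) : ℝ :=
  (∑ s ∈ Finset.Ico a b, x s) / ((b : ℝ) - (a : ℝ))

/-- A subdivision of `ℕ` into consecutive blocks, each of which is itself subdivided into finitely
many consecutive intervals.  The intervals are `[n i, n (i+1))` with `0 = n 0 < n 1 < ⋯`, and the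
`j`-th block consists of the intervals with `p j ≤ i < p (j+1)`, where `0 = p 0 < p 1 < ⋯`. -/
structure Subdivision where
  n : ℕ → ℕ
  p : ℕ → ℕ
  n_zero : n 0 = 0
  p_zero : p 0 = 0
  n_strictMono : StrictMono n
  p_strictMono : StrictMono p

namespace Subdivision

/-- The double average over the `j`-th block: the arithmetic mean of the averages over the
`p (j+1) - p j` intervals that make up the block. -/
def doubleAvg (S : Subdivision) (j : ℕ) (x : JamesSpace) : ℝ :=
  (∑ i ∈ Finset.Ico (S.p j) (S.p (j + 1)), avg (S.n i) (S.n (i + 1)) x) /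
    ((S.p (j + 1) : ℝ) - (S.p j : ℝ))

/-- `g_j`, the sum of the basis vectors `e_i` over all the indices `i` in the `j`-th block. -/
def blockVec (S : Subdivision) (j : ℕ) : JamesSpace :=
  ∑ i ∈ Finset.Ico (S.n (S.p j)) (S.n (S.p (j + 1))), basisVec i

/-- `V x = x - ∑_{j=0}^∞ A_j(x) g_j` for all `x ∈ J`, where the series converges in the norm
of `J` (as the limit of its partial sums). -/
def IsAveragingPerturbation (S : Subdivision) (V : JamesSpace →L[ℝ] JamesSpace) : Prop :=
  ∀ x : JamesSpace,
    Tendsto (fun N : ℕ => x - ∑ j ∈ Finset.range N, S.doubleAvg j x • S.blockVec j)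
      atTop (𝓝 (V x))

end Subdivision

end JamesSpace

/-- A subset of a normed space that is compact for the weak topology. -/
def IsWeaklyCompactSet {E : Type*} [NormedAddCommGroup E] [NormedSpace ℝ E] (D : Set E) : Prop :=
  IsCompact (toWeakSpace ℝ E '' D)

/-- A bounded operator that maps the closed unit ball onto a relatively weakly compact set. -/
def IsWeaklyCompactOperator {E F : Type*} [NormedAddCommGroup E] [NormedSpace ℝ E]
    [NormedAddCommGroup F] [NormedSpace ℝ F] (V : E →L[ℝ] F) : Prop :=
  IsCompact (closure (toWeakSpace ℝ F '' (V '' Metric.closedBall (0 : E) 1)))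

/-- The Banach space `E` has the (bounded) weakly compact approximation property with constant `C`.
The supremum of `‖x - V x‖` over `D` is taken in `[0, ∞]`. -/
def HasWAPWith (E : Type*) [NormedAddCommGroup E] [NormedSpace ℝ E] [CompleteSpace E]
    (C : ℝ) : Prop :=
  ∀ D : Set E, IsWeaklyCompactSet D → ∀ ε : ℝ, 0 < ε →
    ∃ V : E →L[ℝ] E, IsWeaklyCompactOperator V ∧
      (⨆ x ∈ D, ‖x - V x‖ₑ) < ENNReal.ofReal ε ∧ ‖V‖ ≤ C

/-- The Banach space `E` has the weakly compact approximation property. -/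
def HasWAP (E : Type*) [NormedAddCommGroup E] [NormedSpace ℝ E] [CompleteSpace E] : Prop :=
  ∃ C : ℝ, HasWAPWith E C

end

/-! Write `V = I - P`, where `P x` is constant on each block with value the double average of `x`
there. The bound `‖P‖ ≤ 1` comes from convexity (`sqVarNorm_le_of_mem_convexHull`): sums of squared
jumps are convex in the sampled values, so replacing each average by a suitable value of `x` in the
same block does not decrease the sum. Hence `‖V‖ ≤ 2`.

`V` is weakly compact because every double average of `V x` vanishes. A bounded set of such vectors
is weakly compact (`isWeaklyCompactSet_block_averages_zero`). It is compact coordinatewise, and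
functionals are continuous on it for that topology: a functional has square summable norms on the
blocks (`summable_norm_comp_proj_sq`), while a vector with zero block averages is controlled on each
block by its oscillation, which is also square summable (`sum_sqVarNorm_clamp_sq_le`).
Cauchy-Schwarz makes the tails uniformly small.

For a weakly compact `D`, compactness yields intervals on each of which every `x ∈ D` has a small
coordinate (`exists_uniform_small_coord`). The average over an interval is then small up to the
oscillation there. Averaging over `k ^ 2` intervals makes the contribution of the oscillations at
most `R / k` (`abs_doubleAvg_le`). With double averages decaying geometrically, `P x` is uniformly
small on `D`. -/

/-! ### Square variation along monotone index maps, and its superadditivity. -/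

theorem sqVarSum_succ (x : ℕ → ℝ) (n : ℕ) (p : ℕ → ℕ) :
    sqVarSum x (n + 1) p = sqVarSum x n p + |x (p (n + 1)) - x (p n)| ^ 2 :=
  Finset.sum_range_succ _ _

/-- Repeated indices contribute zero jumps and can be deleted. The endpoint equality `q k = p n` is
what lets the induction append the next index. -/
theorem exists_strictMono_sqVarSum_eq (x : ℕ → ℝ) {p : ℕ → ℕ} (hp : Monotone p) (n : ℕ) :
    ∃ (k : ℕ) (q : ℕ → ℕ), StrictMono q ∧ sqVarSum x k q = sqVarSum x n p ∧ q k = p n := by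
  induction n with
  | zero =>
    exact ⟨0, fun i => p 0 + i, fun a b h => by simpa using h, by simp [sqVarSum], rfl⟩
  | succ n ih =>
    obtain ⟨k, q, hq, hs, he⟩ := ih
    rcases (hp (Nat.le_succ n)).eq_or_lt with h | h
    · refine ⟨k, q, hq, ?_, by rw [he, h]⟩
      rw [hs, sqVarSum, sqVarSum, Finset.sum_range_succ, ← h]
      simp
    · refine ⟨k + 1, fun i => if i ≤ k then q i else p (n + 1) + (i - (k + 1)), ?_, ?_, ?_⟩
      · intro a b hab
        have h1 : a ≤ k → q a ≤ q k := fun h => hq.monotone h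
        have h2 := @hq a b hab
        dsimp only
        split_ifs with h3 h4 <;> grind
      · rw [sqVarSum, Finset.sum_range_succ, sqVarSum, Finset.sum_range_succ]
        congr 1
        · rw [← sqVarSum, ← hs]
          refine Finset.sum_congr rfl fun j hj => ?_
          have := Finset.mem_range.1 hj
          rw [if_pos (by omega), if_pos (by omega)]
        · simp [he]
      · simp

theorem sqVarSum_le_of_monotone {x : ℕ → ℝ} (hx : BddAbove (sqVarSet x)) (n : ℕ) {p : ℕ → ℕ}
    (hp : Monotone p) : sqVarSum x n p ≤ sqVarNorm x ^ 2 := by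
  obtain ⟨k, q, hq, h, -⟩ := exists_strictMono_sqVarSum_eq x hp n
  exact h ▸ sqVarSum_le hx k hq

theorem sqVarNorm_sq_le {x : ℕ → ℝ} {c : ℝ}
    (h : ∀ n p, StrictMono p → sqVarSum x n p ≤ c) : sqVarNorm x ^ 2 ≤ c := by
  rw [sqVarNorm, Real.sq_sqrt]
  · refine csSup_le (sqVarSet_nonempty x) ?_
    rintro s ⟨n, p, hp, rfl⟩
    exact h n p hp
  · apply Real.sSup_nonneg
    rintro s ⟨n, p, -, rfl⟩
    exact sqVarSum_nonneg x n p

theorem sqVarNorm_comp_le {x : ℕ → ℝ} (hx : BddAbove (sqVarSet x)) {φ : ℕ → ℕ}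
    (hφ : Monotone φ) :
    BddAbove (sqVarSet (x ∘ φ)) ∧ sqVarNorm (x ∘ φ) ≤ sqVarNorm x :=
  sqVarNorm_le (sqVarNorm_nonneg x) fun n _ hp =>
    sqVarSum_le_of_monotone hx n (hφ.comp hp.monotone)

/-- Concatenate the two index families; the extra jump from `p n` to `q 0` only adds a nonnegative
term. -/
theorem exists_sqVarSum_add_le (x : ℕ → ℝ) {p q : ℕ → ℕ} (hp : Monotone p) (hq : Monotone q)
    (n k : ℕ) (h : p n ≤ q 0) :
    ∃ r, Monotone r ∧ sqVarSum x n p + sqVarSum x k q ≤ sqVarSum x (n + 1 + k) r := by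
  refine ⟨fun i => if i ≤ n then p i else q (i - (n + 1)), ?_, ?_⟩
  · intro a b hab
    have h1 : a ≤ n → p a ≤ p n := fun h => hp h
    have h2 := hp hab
    have h3 : q 0 ≤ q (b - (n + 1)) := hq (Nat.zero_le _)
    have h4 : q (a - (n + 1)) ≤ q (b - (n + 1)) := hq (by omega)
    dsimp only
    split_ifs with h5 h6 <;> grind
  · rw [sqVarSum, sqVarSum, sqVarSum, Finset.sum_range_add, Finset.sum_range_succ]
    refine add_le_add (le_add_of_le_of_nonneg (Finset.sum_le_sum fun j hj => ?_) (by positivity))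
      (Finset.sum_le_sum fun j hj => ?_)
    · have := Finset.mem_range.1 hj
      rw [if_pos (by omega), if_pos (by omega)]
    · rw [if_neg (by omega), if_neg (by omega)]
      have e1 : n + 1 + j + 1 - (n + 1) = j + 1 := by omega
      have e2 : n + 1 + j - (n + 1) = j := by omega
      rw [e1, e2]

/-- The square of the square variation norm is superadditive over successive pieces. -/
theorem sqVarNorm_sq_add_sq_le {x : ℕ → ℝ} (hx : BddAbove (sqVarSet x)) {φ ψ : ℕ → ℕ}
    (hφ : Monotone φ) (hψ : Monotone ψ) (h : ∀ i k, φ i ≤ ψ k) :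
    sqVarNorm (x ∘ φ) ^ 2 + sqVarNorm (x ∘ ψ) ^ 2 ≤ sqVarNorm x ^ 2 := by
  rw [← le_sub_iff_add_le]
  refine sqVarNorm_sq_le fun n p hp => ?_
  rw [le_sub_comm]
  refine sqVarNorm_sq_le fun k q hq => ?_
  rw [le_sub_iff_add_le']
  obtain ⟨r, hr, hle⟩ := exists_sqVarSum_add_le x (hφ.comp hp.monotone) (hψ.comp hq.monotone) n k
    (h _ _)
  exact hle.trans (sqVarSum_le_of_monotone hx _ hr)

theorem monotone_clamp (a b : ℕ) : Monotone fun i => max a (min i b) := by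
  intro i k h
  dsimp only
  omega

/-- Clamping the index freezes `x` outside `[m j, m (j + 1)]`, so each term is the squared variation
of `x` on one block, right endpoint included. Superadditivity is applied inductively to the
truncations at `m N`. -/
theorem sum_sqVarNorm_clamp_sq_le {x : ℕ → ℝ} (hx : BddAbove (sqVarSet x)) {m : ℕ → ℕ}
    (hm : Monotone m) (N : ℕ) :
    ∑ j ∈ Finset.range N, sqVarNorm (x ∘ fun i => max (m j) (min i (m (j + 1)))) ^ 2
      ≤ sqVarNorm x ^ 2 := by
  have hmin : ∀ a : ℕ, Monotone fun i : ℕ => min i a := fun a i k h => by dsimp only; omega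
  have key : ∀ N, ∑ j ∈ Finset.range N, sqVarNorm (x ∘ fun i => max (m j) (min i (m (j + 1)))) ^ 2
      ≤ sqVarNorm (x ∘ fun i => min i (m N)) ^ 2 := by
    intro N
    induction N with
    | zero => simpa using sq_nonneg _
    | succ N ih =>
      rw [Finset.sum_range_succ]
      have hN := hm (Nat.le_succ N)
      have h := sqVarNorm_sq_add_sq_le (sqVarNorm_comp_le hx (hmin (m (N + 1)))).1
        (hmin (m N)) (monotone_clamp (m N) (m (N + 1))) (fun i k => by omega)
      have e1 : (x ∘ fun i => min i (m (N + 1))) ∘ (fun i => min i (m N))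
          = x ∘ fun i => min i (m N) := by
        funext i
        simp only [Function.comp]
        congr 1
        have : m N ≤ m (N + 1) := hN
        omega
      have e2 : (x ∘ fun i => min i (m (N + 1))) ∘ (fun i => max (m N) (min i (m (N + 1))))
          = x ∘ fun i => max (m N) (min i (m (N + 1))) := by
        funext i
        simp only [Function.comp]
        congr 1
        have : m N ≤ m (N + 1) := hN
        omega
      rw [e1, e2] at h
      linarith
  exact (key N).trans (pow_le_pow_left₀ (sqVarNorm_nonneg _) (sqVarNorm_comp_le hx (hmin _)).2 2)

theorem abs_sub_le_sqVarNorm {x : ℕ → ℝ} (hx : BddAbove (sqVarSet x)) (s t : ℕ) :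
    |x t - x s| ≤ sqVarNorm x := by
  wlog h : s ≤ t generalizing s t
  · rw [abs_sub_comm]
    exact this t s (by omega)
  have hp : Monotone fun k : ℕ => if k = 0 then s else t := by
    intro a b hab
    dsimp only
    split_ifs <;> omega
  have := sqVarSum_le_of_monotone hx 1 hp
  simp only [sqVarSum, Finset.range_one, Finset.sum_singleton] at this
  simpa using le_of_sq_le_sq this (sqVarNorm_nonneg x)

/-- A sequence with only one jump. -/
theorem sqVarNorm_step (c : ℝ) (a : ℕ) :
    BddAbove (sqVarSet fun i => if i < a then c else 0) ∧
      sqVarNorm (fun i => if i < a then c else 0) ≤ |c| := by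
  refine sqVarNorm_le (abs_nonneg c) fun n p hp => ?_
  -- Strengthened for induction: nothing is spent until the indices pass `a`, and only one jump
  -- passes it.
  have key : ∀ n, sqVarSum (fun i => if i < a then c else 0) n p ≤
      if p n < a then 0 else |c| ^ 2 := by
    intro n
    induction n with
    | zero => simp only [sqVarSum, Finset.range_zero, Finset.sum_empty]; split_ifs <;> positivity
    | succ n ih =>
      have : p n < p (n + 1) := hp (Nat.lt_add_one n)
      rw [sqVarSum_succ]
      split_ifs at ih ⊢ <;> first | omega | simp_all
  refine (key n).trans ?_
  split_ifs <;> first | positivity | rfl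

/-! ### Coordinate projections, the basis property and `ℓ²`-estimates in `J`. -/

namespace JamesSpace

@[simp] theorem sum_apply {ι : Type*} (s : Finset ι) (u : ι → JamesSpace) (i : ℕ) :
    (∑ j ∈ s, u j) i = ∑ j ∈ s, u j i := by
  classical
  induction s using Finset.induction_on with
  | empty => simp
  | insert a s ha ih => rw [Finset.sum_insert ha, Finset.sum_insert ha, add_apply, ih]

theorem basisVec_apply (k i : ℕ) : basisVec k i = if i = k then 1 else 0 :=
  Pi.single_apply k (1 : ℝ) i

theorem sum_smul_basisVec_apply (s : Finset ℕ) (c : ℕ → ℝ) (i : ℕ) :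
    (∑ k ∈ s, c k • basisVec k) i = if i ∈ s then c i else 0 := by
  simp [basisVec_apply]

/-- The coordinate functionals of `J`. -/
noncomputable def coord (i : ℕ) : JamesSpace →L[ℝ] ℝ :=
  LinearMap.mkContinuous
    { toFun := fun x => x i, map_add' := fun _ _ => rfl, map_smul' := fun _ _ => rfl } 1
    fun x => (abs_apply_le x i).trans_eq (one_mul _).symm

@[simp] theorem coord_apply (i : ℕ) (x : JamesSpace) : coord i x = x i := rfl

/-- The coordinate projection onto the span of the basis vectors indexed by `[a, b)`. -/
noncomputable def proj (a b : ℕ) : JamesSpace →L[ℝ] JamesSpace :=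
  ∑ i ∈ Finset.Ico a b, (coord i).smulRight (basisVec i)

theorem proj_eq_sum (a b : ℕ) (x : JamesSpace) :
    proj a b x = ∑ i ∈ Finset.Ico a b, x i • basisVec i := by
  simp [proj]

theorem proj_apply (a b : ℕ) (x : JamesSpace) (i : ℕ) :
    proj a b x i = if i ∈ Finset.Ico a b then x i else 0 := by
  rw [proj_eq_sum, sum_smul_basisVec_apply]

theorem proj_proj (a b : ℕ) (x : JamesSpace) : proj a b (proj a b x) = proj a b x :=
  ext fun i => by
    rw [proj_apply, proj_apply]
    split_ifs <;> rfl

theorem norm_le_of_eq {x : JamesSpace} {u v w : ℕ → ℝ} (hu : BddAbove (sqVarSet u))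
    (hv : BddAbove (sqVarSet v)) (hw : BddAbove (sqVarSet w)) (h : ∀ i, x i = u i + v i + w i) :
    ‖x‖ ≤ sqVarNorm u + sqVarNorm v + sqVarNorm w := by
  have h1 := sqVarNorm_add hu hv
  have h2 := sqVarNorm_add h1.1 hw
  have e : (fun i => x i) = u + v + w := funext h
  rw [norm_def, e]
  linarith [h1.2, h2.2]

/-- The clamped sequence equals `x a` before `a` and `x b` from `b` on; one step sequence at each
end removes these constants, at cost `|x a|` and `|x b|`. -/
theorem norm_proj_le {a b : ℕ} (h : a ≤ b) (x : JamesSpace) :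
    ‖proj a b x‖ ≤ sqVarNorm ((fun i => x i) ∘ fun i => max a (min i b)) + |x b| + |x a| := by
  have h1 := sqVarNorm_comp_le x.bddAbove (monotone_clamp a b)
  have h0 : ∀ c : ℝ, BddAbove (sqVarSet fun _ => c) ∧ sqVarNorm (fun _ => c) ≤ 0 :=
    fun c => sqVarNorm_le le_rfl fun n p _ => by simp [sqVarSum]
  have h2 := sqVarNorm_step (x b) b
  have h3 := sqVarNorm_step (-x a) a
  have h4 := sqVarNorm_add h2.1 (h0 (-x b)).1
  refine (norm_le_of_eq h1.1 h4.1 h3.1 fun i => ?_).trans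
    (add_le_add (add_le_add le_rfl (by linarith [h2.2, h4.2, (h0 (-x b)).2])) (h3.2.trans_eq (abs_neg _)))
  rw [proj_apply]
  simp only [Finset.mem_Ico, Function.comp, Pi.add_apply]
  rcases lt_or_ge i a with h5 | h5
  · rw [if_neg (by omega), if_pos (by omega), if_pos h5, min_eq_left (by omega), max_eq_left h5.le]
    ring
  rcases lt_or_ge i b with h6 | h6
  · rw [if_pos ⟨h5, h6⟩, if_pos h6, if_neg (by omega), min_eq_left h6.le, max_eq_right h5]
    ring
  · rw [if_neg (by omega), if_neg (by omega), if_neg (by omega), min_eq_right h6, max_eq_right h]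
    ring

theorem norm_proj_le_three_mul {a b : ℕ} (h : a ≤ b) (x : JamesSpace) :
    ‖proj a b x‖ ≤ 3 * ‖x‖ := by
  have h1 := (sqVarNorm_comp_le x.bddAbove (monotone_clamp a b)).2
  have h2 := abs_apply_le x a
  have h3 := norm_proj_le h x
  have h4 := abs_apply_le x b
  rw [← norm_def] at h1
  linarith

/-- The vectors `e_i` form a Schauder basis of `J`. -/
theorem tendsto_proj (x : JamesSpace) : Tendsto (fun N => proj 0 N x) atTop (𝓝 x) := by
  have hmin : ∀ a : ℕ, Monotone fun i : ℕ => min i a := fun a i k h => by dsimp only; omega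
  have hmax : ∀ a : ℕ, Monotone fun i : ℕ => max a i := fun a i k h => by dsimp only; omega
  have tail : ∀ N, ‖x - proj 0 N x‖ ≤ sqVarNorm ((fun i => x i) ∘ fun i => max N i) + |x N| := by
    intro N
    have h1 := sqVarNorm_comp_le x.bddAbove (hmax N)
    have h2 := sqVarNorm_step (-x N) N
    have h3 := norm_le_of_eq (x := x - proj 0 N x) h1.1 h2.1 sqVarSet_zero.1 fun i => by
      rw [sub_apply, proj_apply]
      simp only [Finset.mem_Ico, Function.comp, Pi.zero_apply, zero_le, true_and]
      rcases lt_or_ge i N with h | h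
      · rw [if_pos h, if_pos h, max_eq_left h.le]
        ring
      · rw [if_neg (by omega), if_neg (by omega), max_eq_right h]
        ring
    have h4 := h2.2
    rw [abs_neg] at h4
    linarith [sqVarSet_zero.2]
  have small : ∀ ε > 0, ∀ᶠ N in atTop, sqVarNorm ((fun i => x i) ∘ fun i => max N i) ≤ ε := by
    intro ε hε
    -- A finite sum ending at `p n` nearly attains the squared norm, so superadditivity leaves at
    -- most `ε ^ 2` for the variation beyond `p n`.
    obtain ⟨n, p, hp, hlt⟩ : ∃ n p, StrictMono p ∧
        sqVarNorm (fun i => x i) ^ 2 - ε ^ 2 < sqVarSum (fun i => x i) n p := by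
      by_contra! hcon
      have := sqVarNorm_sq_le hcon
      nlinarith
    filter_upwards [eventually_ge_atTop (p n)] with N hN
    have h1 := sqVarNorm_sq_add_sq_le x.bddAbove (hmin N) (hmax N) (fun i k => by omega)
    have h2 : sqVarSum (fun i => x i) n p ≤ sqVarNorm ((fun i => x i) ∘ fun i => min i N) ^ 2 := by
      refine le_of_eq_of_le (Finset.sum_congr rfl fun j hj => ?_)
        (sqVarSum_le (sqVarNorm_comp_le x.bddAbove (hmin N)).1 n hp)
      have h3 := Finset.mem_range.1 hj
      have h4 : p j ≤ p n := hp.monotone (by omega)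
      have h5 : p (j + 1) ≤ p n := hp.monotone (by omega)
      simp only [Function.comp]
      rw [min_eq_left (by omega), min_eq_left (by omega)]
    exact le_of_sq_le_sq (by linarith) hε.le
  rw [tendsto_iff_norm_sub_tendsto_zero]
  refine squeeze_zero (fun _ => norm_nonneg _)
    (fun N => (norm_sub_rev _ _).trans_le (tail N)) ?_
  have hx : Tendsto (fun N => |x N|) atTop (𝓝 0) := by simpa using x.tendsto_zero.abs
  have hv : Tendsto (fun N => sqVarNorm ((fun i => x i) ∘ fun i => max N i)) atTop (𝓝 0) := by
    rw [Metric.tendsto_nhds]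
    intro ε hε
    filter_upwards [small (ε / 2) (half_pos hε)] with N hN
    rw [Real.dist_0_eq_abs, abs_of_nonneg (sqVarNorm_nonneg _)]
    linarith
  simpa using hv.add hx

/-- Upper `ℓ²`-estimate for vectors with disjoint supports. -/
theorem norm_sum_sq_le {ι : Type*} (s : Finset ι) (u : ι → JamesSpace)
    (hu : ∀ i, ∃ j, ∀ k, k ≠ j → u k i = 0) :
    ‖∑ j ∈ s, u j‖ ^ 2 ≤ 2 * ∑ j ∈ s, ‖u j‖ ^ 2 := by
  classical
  choose b hb using hu
  -- At each index at most one of the vectors is nonzero, so a difference of two coordinates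
  -- involves at most two of them; this gives the factor `2`.
  have jump : ∀ i k : ℕ, |(∑ j ∈ s, u j) k - (∑ j ∈ s, u j) i| ^ 2
      ≤ 2 * ∑ j ∈ s, |u j k - u j i| ^ 2 := by
    intro i k
    rw [sum_apply, sum_apply, ← Finset.sum_sub_distrib]
    have e : ∑ j ∈ s, (u j k - u j i) = ∑ j ∈ s ∩ {b k, b i}, (u j k - u j i) := by
      refine (Finset.sum_subset Finset.inter_subset_left fun j hj hj' => ?_).symm
      simp only [Finset.mem_inter, hj, true_and, Finset.mem_insert, Finset.mem_singleton,
        not_or] at hj'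
      rw [hb k j hj'.1, hb i j hj'.2, sub_zero]
    rw [e, sq_abs]
    refine sq_sum_le_card_mul_sum_sq.trans (mul_le_mul ?_ ?_ ?_ (by norm_num))
    · exact_mod_cast (Finset.card_le_card Finset.inter_subset_right).trans Finset.card_le_two
    · simp only [sq_abs]
      exact Finset.sum_le_sum_of_subset_of_nonneg Finset.inter_subset_left
        fun _ _ _ => sq_nonneg _
    · exact Finset.sum_nonneg fun _ _ => sq_nonneg _
  refine sqVarNorm_sq_le fun n p hp => (Finset.sum_le_sum fun l _ => jump _ _).trans ?_
  rw [← Finset.mul_sum, Finset.sum_comm]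
  exact mul_le_mul_of_nonneg_left
    (Finset.sum_le_sum fun j _ => sqVarSum_le (u j).bddAbove n hp) (by norm_num)

theorem exists_block {m : ℕ → ℕ} (hm : StrictMono m) (h0 : m 0 = 0) (i : ℕ) :
    ∃ j, m j ≤ i ∧ i < m (j + 1) := by
  refine ⟨Nat.findGreatest (fun j => m j ≤ i) i,
    Nat.findGreatest_spec (P := fun j => m j ≤ i) (Nat.zero_le i) (by omega), ?_⟩
  by_contra! h
  have h1 := Nat.le_findGreatest (P := fun j => m j ≤ i) ((hm.le_apply).trans h) h
  omega

theorem block_unique {m : ℕ → ℕ} (hm : StrictMono m) {i j k : ℕ} (h1 : m j ≤ i)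
    (h2 : i < m (j + 1)) (h3 : m k ≤ i) (h4 : i < m (k + 1)) : j = k := by
  have h5 := hm.lt_iff_lt.1 (h1.trans_lt h4)
  have h6 := hm.lt_iff_lt.1 (h3.trans_lt h2)
  omega

/-- The restrictions of a functional on `J` to consecutive blocks are square summable in norm. -/
theorem summable_norm_comp_proj_sq {m : ℕ → ℕ} (hm : StrictMono m) (h0 : m 0 = 0)
    (f : JamesSpace →L[ℝ] ℝ) :
    Summable fun j => ‖f.comp (proj (m j) (m (j + 1)))‖ ^ 2 := by
  have hx : ∀ j, ∃ x : JamesSpace, ‖x‖ ≤ 1 ∧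
      ‖f.comp (proj (m j) (m (j + 1)))‖ ≤ 2 * |f (proj (m j) (m (j + 1)) x)| := by
    intro j
    rcases (norm_nonneg (f.comp (proj (m j) (m (j + 1))))).eq_or_lt with h | h
    · exact ⟨0, by simp, by rw [← h]; positivity⟩
    · obtain ⟨x, h1, h2⟩ := ContinuousLinearMap.exists_lt_apply_of_lt_opNorm _ (half_lt_self h)
      refine ⟨x, h1.le, ?_⟩
      rw [ContinuousLinearMap.comp_apply, Real.norm_eq_abs] at h2
      linarith
  choose x hx1 hx2 using hx
  set v : ℕ → ℝ := fun j => f (proj (m j) (m (j + 1)) (x j)) with hv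
  -- Duality: `f` takes the value `A = ∑ v j ^ 2` at `∑ v j • proj (x j)`, whose squared norm is at
  -- most `2 * 3 ^ 2 * A`, so `A ≤ 18 * ‖f‖ ^ 2`. The factor `4` comes from `x j` being norming only
  -- up to `2`.
  refine summable_of_sum_range_le (c := 72 * ‖f‖ ^ 2) (fun _ => sq_nonneg _) fun N => ?_
  have h1 : ∑ j ∈ Finset.range N, ‖f.comp (proj (m j) (m (j + 1)))‖ ^ 2
      ≤ 4 * ∑ j ∈ Finset.range N, v j ^ 2 := by
    rw [Finset.mul_sum]
    refine Finset.sum_le_sum fun j _ => ?_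
    refine (pow_le_pow_left₀ (norm_nonneg _) (hx2 j) 2).trans_eq ?_
    rw [mul_pow, sq_abs]
    norm_num [hv]
  have h2 : ‖∑ j ∈ Finset.range N, v j • proj (m j) (m (j + 1)) (x j)‖ ^ 2
      ≤ 18 * ∑ j ∈ Finset.range N, v j ^ 2 := by
    refine (norm_sum_sq_le _ _ fun i => ?_).trans ?_
    · obtain ⟨j, hj1, hj2⟩ := exists_block hm h0 i
      refine ⟨j, fun k hk => ?_⟩
      rw [smul_apply, proj_apply, if_neg, mul_zero]
      intro h
      rw [Finset.mem_Ico] at h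
      exact hk (block_unique hm h.1 h.2 hj1 hj2)
    · rw [Finset.mul_sum, Finset.mul_sum]
      refine Finset.sum_le_sum fun j _ => ?_
      have h3 := norm_proj_le_three_mul (hm.monotone (Nat.le_succ j)) (x j)
      have h4 : ‖proj (m j) (m (j + 1)) (x j)‖ ≤ 3 := h3.trans (by linarith [hx1 j])
      have h5 := pow_le_pow_left₀ (norm_nonneg _) h4 2
      rw [norm_smul, mul_pow, Real.norm_eq_abs, sq_abs]
      nlinarith [sq_nonneg (v j)]
  have h3 : ∑ j ∈ Finset.range N, v j ^ 2
      = f (∑ j ∈ Finset.range N, v j • proj (m j) (m (j + 1)) (x j)) := by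
    simp [hv, sq]
  have h4 := (le_abs_self _).trans
    (f.le_opNorm (∑ j ∈ Finset.range N, v j • proj (m j) (m (j + 1)) (x j)))
  rw [← h3] at h4
  set A := ∑ j ∈ Finset.range N, v j ^ 2
  have hA : 0 ≤ A := Finset.sum_nonneg fun _ _ => sq_nonneg _
  have h5 : A ^ 2 ≤ ‖f‖ ^ 2 * (18 * A) := by
    refine (pow_le_pow_left₀ hA h4 2).trans ?_
    rw [mul_pow]
    exact mul_le_mul_of_nonneg_left h2 (sq_nonneg _)
  have h6 : A ≤ 18 * ‖f‖ ^ 2 := by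
    rcases hA.eq_or_lt with h | h
    · rw [← h]; positivity
    · nlinarith
  linarith

end JamesSpace

/-! ### Weak compactness of bounded sets with vanishing block averages. -/

/-- Since the weighted mean of `y` is zero, `y t` is the weighted mean of the differences `y t - y
s`, each at most the variation on the block. The endpoint `t = b` is allowed because the clamp
includes it. -/
theorem abs_le_sqVarNorm_clamp {y w : ℕ → ℝ} (hy : BddAbove (sqVarSet y)) {a b : ℕ}
    (hw : ∀ s, 0 ≤ w s) (hw1 : ∑ s ∈ Finset.Ico a b, w s = 1)
    (h0 : ∑ s ∈ Finset.Ico a b, w s * y s = 0) {t : ℕ} (hat : a ≤ t) (htb : t ≤ b) :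
    |y t| ≤ sqVarNorm (y ∘ fun i => max a (min i b)) := by
  have e : y t = ∑ s ∈ Finset.Ico a b, w s * (y t - y s) := by
    simp only [mul_sub, Finset.sum_sub_distrib, h0, ← Finset.sum_mul, hw1]
    ring
  rw [e]
  refine (Finset.abs_sum_le_sum_abs _ _).trans ?_
  rw [← one_mul (sqVarNorm _), ← hw1, Finset.sum_mul]
  refine Finset.sum_le_sum fun s hs => ?_
  rw [abs_mul, abs_of_nonneg (hw s)]
  refine mul_le_mul_of_nonneg_left ?_ (hw s)
  have h := abs_sub_le_sqVarNorm (sqVarNorm_comp_le hy (monotone_clamp a b)).1 s t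
  have hs := Finset.mem_Ico.1 hs
  simp only [Function.comp] at h
  rwa [min_eq_left htb, min_eq_left hs.2.le, max_eq_right hat, max_eq_right hs.1] at h

namespace JamesSpace

/-- The block variations are square summable, hence tend to zero, and they dominate the coordinates.
Thus coordinatewise limits of such vectors stay in `J`, although being a null sequence is not a
closed condition. -/
theorem tendsto_zero_of_block_averages {y : ℕ → ℝ} (hy : BddAbove (sqVarSet y)) {m : ℕ → ℕ}
    (hm : StrictMono m) (h0 : m 0 = 0) {w : ℕ → ℕ → ℝ} (hw : ∀ j s, 0 ≤ w j s)
    (hw1 : ∀ j, ∑ s ∈ Finset.Ico (m j) (m (j + 1)), w j s = 1)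
    (hy0 : ∀ j, ∑ s ∈ Finset.Ico (m j) (m (j + 1)), w j s * y s = 0) :
    Tendsto y atTop (𝓝 0) := by
  have hs : Summable fun j => sqVarNorm (y ∘ fun i => max (m j) (min i (m (j + 1)))) ^ 2 :=
    summable_of_sum_range_le (fun _ => sq_nonneg _) (sum_sqVarNorm_clamp_sq_le hy hm.monotone)
  have h1 := hs.tendsto_atTop_zero
  rw [Metric.tendsto_atTop]
  intro ε hε
  obtain ⟨N, hN⟩ := eventually_atTop.1 (h1.eventually_lt_const (pow_pos hε 2))
  refine ⟨m N, fun i hi => ?_⟩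
  obtain ⟨j, hj1, hj2⟩ := exists_block hm h0 i
  have hj : N ≤ j := by
    have := hm.lt_iff_lt.1 (hi.trans_lt hj2)
    omega
  rw [Real.dist_0_eq_abs]
  exact (abs_le_sqVarNorm_clamp hy (hw j) (hw1 j) (hy0 j) hj1
    hj2.le).trans_lt (lt_of_pow_lt_pow_left₀ 2 hε.le (hN j hj))

theorem proj_zero_eq_sum {m : ℕ → ℕ} (hm : StrictMono m) (h0 : m 0 = 0) (N : ℕ) (x : JamesSpace) :
    proj 0 (m N) x = ∑ j ∈ Finset.range N, proj (m j) (m (j + 1)) x := by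
  induction N with
  | zero => simp [proj_eq_sum, h0]
  | succ N ih =>
    rw [Finset.sum_range_succ, ← ih, proj_eq_sum, proj_eq_sum, proj_eq_sum,
      Finset.sum_Ico_consecutive _ (Nat.zero_le _) (hm.monotone (Nat.le_succ N))]

theorem isWeaklyCompactSet_block_averages_zero {m : ℕ → ℕ}
    (hm : StrictMono m) (h0 : m 0 = 0) {w : ℕ → ℕ → ℝ} (hw : ∀ j s, 0 ≤ w j s)
    (hw1 : ∀ j, ∑ s ∈ Finset.Ico (m j) (m (j + 1)), w j s = 1) {R : ℝ} (hR : 0 ≤ R) :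
    IsWeaklyCompactSet {y : JamesSpace | ‖y‖ ≤ R ∧
      ∀ j, ∑ s ∈ Finset.Ico (m j) (m (j + 1)), w j s * y s = 0} := by
  -- Only coordinatewise closed conditions are imposed; convergence to zero is recovered from the
  -- vanishing averages.
  set K : Set (ℕ → ℝ) := {y | (∀ i, y i ∈ Set.Icc (-R) R) ∧
    (∀ n p, StrictMono p → sqVarSum y n p ≤ R ^ 2) ∧
    ∀ j, ∑ s ∈ Finset.Ico (m j) (m (j + 1)), w j s * y s = 0} with hK
  have hKc : IsCompact K := by
    refine (isCompact_univ_pi fun _ : ℕ => isCompact_Icc (a := -R) (b := R)).of_isClosed_subset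
      ?_ fun y hy i _ => hy.1 i
    simp only [hK, Set.ofPred_and, Set.ofPred_forall]
    refine IsClosed.inter (isClosed_iInter fun i => isClosed_Icc.preimage (continuous_apply i))
      (IsClosed.inter (isClosed_iInter fun n => isClosed_iInter fun p => isClosed_iInter fun _ =>
        isClosed_le ?_ continuous_const) (isClosed_iInter fun j => isClosed_eq ?_ continuous_const))
    · unfold sqVarSum
      fun_prop
    · fun_prop
  have hmem : ∀ y : K, (y : ℕ → ℝ) ∈ jamesSubmodule := fun y =>
    have hb := (sqVarNorm_le hR y.2.2.1).1
    ⟨tendsto_zero_of_block_averages hb hm h0 hw hw1 y.2.2.2, hb⟩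
  let Φ : K → JamesSpace := fun y => ⟨y, hmem y⟩
  have hΦ : ∀ y : K, ‖Φ y‖ ≤ R := fun y => (sqVarNorm_le hR y.2.2.1).2
  have hcont : ∀ f : JamesSpace →L[ℝ] ℝ, Continuous fun y : K => f (Φ y) := by
    intro f
    have hsum := summable_norm_comp_proj_sq hm h0 f
    set r : ℕ → ℝ := fun j => ‖f.comp (proj (m j) (m (j + 1)))‖ with hr
    have htail := tendsto_sum_nat_add fun j => r j ^ 2
    have hblock : ∀ (y : K) j, |f (proj (m j) (m (j + 1)) (Φ y))| ≤
        r j * (3 * sqVarNorm ((y : ℕ → ℝ) ∘ fun i => max (m j) (min i (m (j + 1))))) := by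
      intro y j
      have hb := (Φ y).bddAbove
      have hj : m j ≤ m (j + 1) := hm.monotone (Nat.le_succ j)
      have h1 := (f.comp (proj (m j) (m (j + 1)))).le_opNorm (proj (m j) (m (j + 1)) (Φ y))
      rw [ContinuousLinearMap.comp_apply, proj_proj, Real.norm_eq_abs] at h1
      refine h1.trans (mul_le_mul_of_nonneg_left ?_ (norm_nonneg _))
      have h2 := norm_proj_le hj (Φ y)
      have h3 := abs_le_sqVarNorm_clamp hb (hw j) (hw1 j) (y.2.2.2 j) hj le_rfl
      have h4 := abs_le_sqVarNorm_clamp hb (hw j) (hw1 j) (y.2.2.2 j) le_rfl hj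
      linarith
    -- The error after `N` blocks is a sum of blockwise products; Cauchy-Schwarz bounds it by the
    -- tail of `r`, uniformly in `y`. So `f` is a uniform limit of functions of finitely many
    -- coordinates.
    have happrox : ∀ N (y : K), |f (Φ y) - f (proj 0 (m N) (Φ y))| ≤
        3 * R * Real.sqrt (∑' j, r (j + N) ^ 2) := by
      intro N y
      have hlim : Tendsto (fun M => |f (proj 0 (m (M + N)) (Φ y)) - f (proj 0 (m N) (Φ y))|) atTop
          (𝓝 |f (Φ y) - f (proj 0 (m N) (Φ y))|) :=
        ((((f.continuous.tendsto _).comp (tendsto_proj (Φ y))).comp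
          (hm.tendsto_atTop.comp (tendsto_add_atTop_nat N))).sub_const _).abs
      refine le_of_tendsto' hlim fun M => ?_
      have e : f (proj 0 (m (M + N)) (Φ y)) - f (proj 0 (m N) (Φ y))
          = ∑ j ∈ Finset.range M, f (proj (m (j + N)) (m (j + N + 1)) (Φ y)) := by
        rw [proj_zero_eq_sum hm h0, proj_zero_eq_sum hm h0, map_sum, map_sum, add_comm M N,
          Finset.sum_range_add, add_sub_cancel_left]
        simp only [add_comm N]
      rw [e]
      refine ((Finset.abs_sum_le_sum_abs _ _).trans
        (Finset.sum_le_sum fun j _ => hblock y (j + N))).trans ?_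
      refine (Real.sum_mul_le_sqrt_mul_sqrt _ _ _).trans ?_
      rw [mul_comm]
      refine mul_le_mul ?_ (Real.sqrt_le_sqrt ?_) (Real.sqrt_nonneg _) (by positivity)
      · refine Real.sqrt_le_iff.2 ⟨by positivity, ?_⟩
        have hm' : Monotone fun j => m (j + N) := fun a b hab => hm.monotone (by omega)
        have h1 := sum_sqVarNorm_clamp_sq_le (Φ y).bddAbove hm' M
        have h2 : sqVarNorm (fun i => Φ y i) ^ 2 ≤ R ^ 2 :=
          pow_le_pow_left₀ (sqVarNorm_nonneg _) (hΦ y) 2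
        simp only [mul_pow, ← Finset.mul_sum]
        refine mul_le_mul_of_nonneg_left ?_ (by norm_num)
        refine le_trans (le_of_eq ?_) (h1.trans h2)
        refine Finset.sum_congr rfl fun j _ => ?_
        rw [add_right_comm]
      · exact ((summable_nat_add_iff N).2 hsum).sum_le_tsum _ fun _ _ => sq_nonneg _
    have hunif : TendstoUniformly (fun N (y : K) => f (proj 0 (m N) (Φ y)))
        (fun y => f (Φ y)) atTop := by
      have hz : Tendsto (fun N => 3 * R * Real.sqrt (∑' j, r (j + N) ^ 2)) atTop (𝓝 0) := by
        simpa using (htail.sqrt).const_mul (3 * R)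
      rw [Metric.tendstoUniformly_iff]
      intro ε hε
      filter_upwards [hz.eventually_lt_const hε] with N hN y
      exact (happrox N y).trans_lt hN
    refine hunif.continuous (Frequently.of_forall fun N => ?_)
    simp only [proj_eq_sum, map_sum, map_smul, smul_eq_mul]
    refine continuous_finsetSum _ fun i _ => Continuous.mul ?_ continuous_const
    exact (continuous_apply i).comp continuous_subtype_val
  have : CompactSpace K := isCompact_iff_compactSpace.1 hKc
  have hcomp : IsCompact (Set.range fun y : K => toWeakSpace ℝ JamesSpace (Φ y)) :=
    isCompact_range (WeakBilin.continuous_of_continuous_eval _ hcont)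
  suffices e : toWeakSpace ℝ JamesSpace '' {y : JamesSpace | ‖y‖ ≤ R ∧
      ∀ j, ∑ s ∈ Finset.Ico (m j) (m (j + 1)), w j s * y s = 0}
      = Set.range fun y : K => toWeakSpace ℝ JamesSpace (Φ y) by rw [IsWeaklyCompactSet, e]; exact hcomp
  ext z
  constructor
  · rintro ⟨y, ⟨hyR, hy0⟩, rfl⟩
    exact ⟨⟨fun i => y i, fun i => abs_le.1 ((abs_apply_le y i).trans hyR), fun n p hp =>
      (sqVarSum_le y.bddAbove n hp).trans (pow_le_pow_left₀ (sqVarNorm_nonneg _) hyR 2), hy0⟩, rfl⟩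
  · rintro ⟨y, rfl⟩
    exact ⟨Φ y, ⟨hΦ y, y.2.2.2⟩, rfl⟩

end JamesSpace

/-! ### Averaging operators: contractivity, convergence and weak compactness of the perturbation. -/

/-- Averaging a sequence over consecutive blocks does not increase the square variation norm. -/
theorem sqVarNorm_le_of_mem_convexHull {x a : ℕ → ℝ} (hx : BddAbove (sqVarSet x)) {m : ℕ → ℕ}
    (hm : Monotone m) (ha : ∀ j, a j ∈ convexHull ℝ (x '' Set.Ico (m j) (m (j + 1)))) :
    BddAbove (sqVarSet a) ∧ sqVarNorm a ≤ sqVarNorm x := by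
  refine sqVarNorm_le (sqVarNorm_nonneg x) fun n p hp => ?_
  let F : (Fin (n + 1) → ℝ) → ℝ := fun v => ∑ j : Fin n, (v j.succ - v j.castSucc) ^ 2
  have hF : ConvexOn ℝ Set.univ F := by
    refine ⟨convex_univ, fun v _ w _ α β hα hβ hαβ => ?_⟩
    simp only [F, smul_eq_mul, Finset.mul_sum, ← Finset.sum_add_distrib]
    refine Finset.sum_le_sum fun j _ => ?_
    have h := (even_two.convexOn_pow (𝕜 := ℝ)).2 (Set.mem_univ (v j.succ - v j.castSucc))
      (Set.mem_univ (w j.succ - w j.castSucc)) hα hβ hαβ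
    simp only [smul_eq_mul] at h
    refine le_of_eq_of_le ?_ h
    simp only [Pi.add_apply, Pi.smul_apply, smul_eq_mul]
    ring
  have hmem : (fun k : Fin (n + 1) => a (p k)) ∈ convexHull ℝ
      (Set.univ.pi fun k : Fin (n + 1) => x '' Set.Ico (m (p k)) (m (p k + 1))) :=
    mem_convexHull_pi fun k _ => ha (p k)
  -- A convex function at a point of a convex hull is bounded by its value at some generating point:
  -- here, a choice of one actual value of `x` in each sampled block.
  obtain ⟨b, hb, hle⟩ := hF.exists_ge_of_mem_convexHull (Set.subset_univ _) hmem
  choose t ht htb using fun k => hb k (Set.mem_univ k)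
  -- The chosen indices lie in successive blocks, hence are ordered; they are continued by a
  -- constant beyond `n`.
  have hq : Monotone fun i : ℕ => t ⟨min i n, by omega⟩ := by
    refine monotone_nat_of_le_succ fun i => ?_
    rcases lt_or_ge i n with h | h
    · have h1 := (ht ⟨min i n, by omega⟩).2
      have h2 := (ht ⟨min (i + 1) n, by omega⟩).1
      have h3 : p (min i n) < p (min (i + 1) n) := hp (by omega)
      exact h1.le.trans ((hm h3).trans h2)
    · simp only [min_eq_right h, min_eq_right (Nat.le_succ_of_le h), le_refl]
  have h1 : sqVarSum a n p = F fun k => a (p k) := by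
    simp [F, sqVarSum, Finset.sum_range]
  have h2 : sqVarSum x n (fun i => t ⟨min i n, by omega⟩) = F b := by
    simp only [F, sqVarSum, Finset.sum_range, sq_abs]
    refine Finset.sum_congr rfl fun j _ => ?_
    rw [← htb j.succ, ← htb j.castSucc]
    congr 4
    · simp only [Fin.ext_iff, Fin.val_succ]; omega
    · simp only [Fin.ext_iff, Fin.val_castSucc]; omega
  rw [h1]
  exact hle.trans (h2 ▸ sqVarSum_le_of_monotone hx n hq)

namespace JamesSpace

theorem avg_eq_sum (a b : ℕ) (x : JamesSpace) :
    avg a b x = ∑ s ∈ Finset.Ico a b, ((b : ℝ) - a)⁻¹ * x s := by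
  rw [avg, div_eq_inv_mul, Finset.mul_sum]

theorem abs_avg_le {a b : ℕ} (h : a < b) {x : JamesSpace} {c : ℝ}
    (hc : ∀ s, a ≤ s → s < b → |x s| ≤ c) : |avg a b x| ≤ c := by
  have hab : (0 : ℝ) < b - a := sub_pos.2 (Nat.cast_lt.2 h)
  rw [avg, abs_div, abs_of_pos hab, div_le_iff₀ hab]
  refine (Finset.abs_sum_le_sum_abs _ _).trans
    ((Finset.sum_le_card_nsmul _ _ c fun s hs => ?_).trans_eq ?_)
  · exact hc s (Finset.mem_Ico.1 hs).1 (Finset.mem_Ico.1 hs).2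
  · rw [Nat.card_Ico, nsmul_eq_mul, Nat.cast_sub h.le, mul_comm]

namespace Subdivision

variable (S : Subdivision)

/-- The first index of the `j`-th block. -/
def start (j : ℕ) : ℕ := S.n (S.p j)

theorem start_strictMono : StrictMono S.start := S.n_strictMono.comp S.p_strictMono

theorem start_zero : S.start 0 = 0 := by rw [start, S.p_zero, S.n_zero]

/-- The weight of the index `s` in the double average over the `j`-th block. -/
noncomputable def weight (j s : ℕ) : ℝ :=
  ∑ i ∈ Finset.Ico (S.p j) (S.p (j + 1)),
    if s ∈ Finset.Ico (S.n i) (S.n (i + 1)) then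
      ((S.p (j + 1) : ℝ) - S.p j)⁻¹ * ((S.n (i + 1) : ℝ) - S.n i)⁻¹ else 0

theorem weight_nonneg (j s : ℕ) : 0 ≤ S.weight j s := by
  refine Finset.sum_nonneg fun i _ => ?_
  have h1 : (0 : ℝ) < (S.p (j + 1) : ℝ) - S.p j :=
    sub_pos.2 (Nat.cast_lt.2 (S.p_strictMono (Nat.lt_succ_self j)))
  have h2 : (0 : ℝ) < (S.n (i + 1) : ℝ) - S.n i :=
    sub_pos.2 (Nat.cast_lt.2 (S.n_strictMono (Nat.lt_succ_self i)))
  split_ifs <;> positivity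

theorem sum_weight_mul (j : ℕ) (y : ℕ → ℝ) :
    ∑ s ∈ Finset.Ico (S.start j) (S.start (j + 1)), S.weight j s * y s =
      ∑ i ∈ Finset.Ico (S.p j) (S.p (j + 1)), ((S.p (j + 1) : ℝ) - S.p j)⁻¹ *
        ∑ s ∈ Finset.Ico (S.n i) (S.n (i + 1)), ((S.n (i + 1) : ℝ) - S.n i)⁻¹ * y s := by
  simp only [weight, Finset.sum_mul]
  rw [Finset.sum_comm]
  refine Finset.sum_congr rfl fun i hi => ?_
  have hi := Finset.mem_Ico.1 hi
  have h1 : S.start j ≤ S.n i := S.n_strictMono.monotone hi.1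
  have h2 : S.n (i + 1) ≤ S.start (j + 1) := S.n_strictMono.monotone (Nat.succ_le_of_lt hi.2)
  rw [Finset.mul_sum, ← Finset.sum_subset (Finset.Ico_subset_Ico h1 h2)]
  · refine Finset.sum_congr rfl fun s hs => ?_
    rw [if_pos hs, mul_assoc]
  · intro s _ hs
    rw [if_neg hs, zero_mul]

theorem doubleAvg_eq_sum (j : ℕ) (x : JamesSpace) : S.doubleAvg j x =
    ∑ s ∈ Finset.Ico (S.start j) (S.start (j + 1)), S.weight j s * x s := by
  rw [sum_weight_mul, doubleAvg, div_eq_inv_mul, Finset.mul_sum]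
  simp only [avg_eq_sum]

theorem sum_weight (j : ℕ) :
    ∑ s ∈ Finset.Ico (S.start j) (S.start (j + 1)), S.weight j s = 1 := by
  have h := S.sum_weight_mul j fun _ => 1
  have h1 : (0 : ℝ) < (S.p (j + 1) : ℝ) - S.p j :=
    sub_pos.2 (Nat.cast_lt.2 (S.p_strictMono (Nat.lt_succ_self j)))
  have h2 : ∀ i, ((S.n (i + 1) : ℝ) - S.n i) ≠ 0 := fun i =>
    (sub_pos.2 (Nat.cast_lt.2 (S.n_strictMono (Nat.lt_succ_self i)))).ne'
  simp only [mul_one, Finset.sum_const, Nat.card_Ico, nsmul_eq_mul,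
    Nat.cast_sub (S.n_strictMono.monotone (Nat.le_succ _)),
    Nat.cast_sub (S.p_strictMono.monotone (Nat.le_succ _)), mul_inv_cancel₀ (h2 _),
    mul_inv_cancel₀ h1.ne'] at h
  exact h

theorem doubleAvg_mem_convexHull (j : ℕ) (x : JamesSpace) : S.doubleAvg j x ∈
    convexHull ℝ ((fun i => x i) '' Set.Ico (S.start j) (S.start (j + 1))) := by
  rw [doubleAvg_eq_sum]
  refine (convex_convexHull ℝ _).sum_mem (fun s _ => S.weight_nonneg j s) (S.sum_weight j)
    fun s hs => subset_convexHull ℝ _ ⟨s, Finset.coe_Ico (S.start j) _ ▸ hs, rfl⟩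

theorem sqVarNorm_doubleAvg_le (x : JamesSpace) :
    BddAbove (sqVarSet fun j => S.doubleAvg j x) ∧ sqVarNorm (fun j => S.doubleAvg j x) ≤ ‖x‖ :=
  sqVarNorm_le_of_mem_convexHull x.bddAbove S.start_strictMono.monotone
    fun j => S.doubleAvg_mem_convexHull j x

/-- The number of the block that contains a given index. -/
noncomputable def blockIndex (i : ℕ) : ℕ :=
  (exists_block S.start_strictMono S.start_zero i).choose

theorem start_blockIndex_le (i : ℕ) : S.start (S.blockIndex i) ≤ i :=
  (exists_block S.start_strictMono S.start_zero i).choose_spec.1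

theorem lt_start_blockIndex_succ (i : ℕ) : i < S.start (S.blockIndex i + 1) :=
  (exists_block S.start_strictMono S.start_zero i).choose_spec.2

theorem blockIndex_eq {i j : ℕ} (h : i ∈ Finset.Ico (S.start j) (S.start (j + 1))) :
    S.blockIndex i = j :=
  block_unique S.start_strictMono (S.start_blockIndex_le i) (S.lt_start_blockIndex_succ i)
    (Finset.mem_Ico.1 h).1 (Finset.mem_Ico.1 h).2

theorem blockIndex_monotone : Monotone S.blockIndex := by
  intro i k h
  have h1 := S.start_strictMono.lt_iff_lt.1
    ((S.start_blockIndex_le i).trans_lt (h.trans_lt (S.lt_start_blockIndex_succ k)))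
  omega

/-- Balls are convex, so once all values of `x` on a block are within `ε` of zero, so is its double
average. -/
theorem tendsto_doubleAvg_blockIndex (x : JamesSpace) :
    Tendsto (fun i => S.doubleAvg (S.blockIndex i) x) atTop (𝓝 0) := by
  rw [Metric.tendsto_atTop]
  intro ε hε
  obtain ⟨N, hN⟩ := Metric.tendsto_atTop.1 x.tendsto_zero ε hε
  refine ⟨S.start N, fun i hi => ?_⟩
  have hj : N ≤ S.blockIndex i := by
    have := S.start_strictMono.lt_iff_lt.1 (hi.trans_lt (S.lt_start_blockIndex_succ i))
    omega
  refine convexHull_min ?_ (convex_ball (0 : ℝ) ε) (S.doubleAvg_mem_convexHull (S.blockIndex i) x)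
  rintro _ ⟨s, hs, rfl⟩
  exact hN s (S.start_strictMono.le_apply.trans ((S.start_strictMono.monotone hj).trans hs.1))

theorem mem_jamesSubmodule_doubleAvg (x : JamesSpace) :
    (fun i => S.doubleAvg (S.blockIndex i) x) ∈ jamesSubmodule :=
  ⟨S.tendsto_doubleAvg_blockIndex x,
    (sqVarNorm_comp_le (S.sqVarNorm_doubleAvg_le x).1 S.blockIndex_monotone).1⟩

/-- The averaging operator `x ↦ ∑_j A_j(x) g_j`. -/
noncomputable def averaging : JamesSpace →L[ℝ] JamesSpace :=
  LinearMap.mkContinuous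
    { toFun := fun x => ⟨fun i => S.doubleAvg (S.blockIndex i) x, S.mem_jamesSubmodule_doubleAvg x⟩
      map_add' := fun x y => JamesSpace.ext fun i => by
        change S.doubleAvg _ (x + y) = S.doubleAvg _ x + S.doubleAvg _ y
        simp only [doubleAvg_eq_sum, add_apply, mul_add, Finset.sum_add_distrib]
      map_smul' := fun c x => JamesSpace.ext fun i => by
        change S.doubleAvg _ (c • x) = c * S.doubleAvg _ x
        simp only [doubleAvg_eq_sum, smul_apply, Finset.mul_sum, mul_left_comm] } 1
    fun x => by
      have h := S.sqVarNorm_doubleAvg_le x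
      rw [one_mul]
      exact (sqVarNorm_comp_le h.1 S.blockIndex_monotone).2.trans h.2

theorem averaging_apply (x : JamesSpace) (i : ℕ) :
    S.averaging x i = S.doubleAvg (S.blockIndex i) x := rfl

theorem norm_averaging_apply_le (x : JamesSpace) :
    ‖S.averaging x‖ ≤ sqVarNorm fun j => S.doubleAvg j x :=
  (sqVarNorm_comp_le (S.sqVarNorm_doubleAvg_le x).1 S.blockIndex_monotone).2

theorem norm_averaging_le : ‖S.averaging‖ ≤ 1 :=
  LinearMap.mkContinuous_norm_le _ zero_le_one _

/-- This identifies the partial sums of the series with coordinate projections of `S.averaging x`,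
so that norm convergence is the basis property. -/
theorem proj_averaging (j : ℕ) (x : JamesSpace) :
    proj (S.start j) (S.start (j + 1)) (S.averaging x) = S.doubleAvg j x • S.blockVec j := by
  rw [proj_eq_sum, blockVec, Finset.smul_sum]
  refine Finset.sum_congr rfl fun i hi => ?_
  rw [averaging_apply, S.blockIndex_eq hi]

theorem isAveragingPerturbation : S.IsAveragingPerturbation (.id ℝ JamesSpace - S.averaging) := by
  intro x
  have h := ((tendsto_proj (S.averaging x)).comp S.start_strictMono.tendsto_atTop).const_sub x
  refine h.congr fun N => ?_
  simp only [Function.comp, proj_zero_eq_sum S.start_strictMono S.start_zero, proj_averaging]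

theorem norm_id_sub_averaging_le : ‖ContinuousLinearMap.id ℝ JamesSpace - S.averaging‖ ≤ 2 := by
  have h1 := S.norm_averaging_le
  have h2 := ContinuousLinearMap.norm_id_le (𝕜 := ℝ) (E := JamesSpace)
  have h3 := norm_sub_le (ContinuousLinearMap.id ℝ JamesSpace) S.averaging
  linarith

/-- On the `j`-th block the averaged vector is the constant `S.doubleAvg j x`, and the weights sum
to one; hence all double averages of the image vanish, and its norm is at most `2` on the unit ball.
-/
theorem isWeaklyCompactOperator_id_sub_averaging :
    IsWeaklyCompactOperator (.id ℝ JamesSpace - S.averaging) := by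
  have hK := isWeaklyCompactSet_block_averages_zero S.start_strictMono S.start_zero
    S.weight_nonneg S.sum_weight zero_le_two
  refine IsCompact.closure_of_subset hK (Set.image_mono ?_)
  rintro _ ⟨x, hx, rfl⟩
  have hx1 : ‖x‖ ≤ 1 := by simpa using hx
  refine ⟨?_, fun j => ?_⟩
  · refine ((ContinuousLinearMap.id ℝ JamesSpace - S.averaging).le_opNorm x).trans ?_
    nlinarith [S.norm_id_sub_averaging_le, norm_nonneg x,
      norm_nonneg (ContinuousLinearMap.id ℝ JamesSpace - S.averaging)]
  · have h : ∀ s ∈ Finset.Ico (S.start j) (S.start (j + 1)),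
        S.weight j s * (ContinuousLinearMap.id ℝ JamesSpace - S.averaging) x s
          = S.weight j s * x s - S.weight j s * S.doubleAvg j x := by
      intro s hs
      rw [_root_.sub_apply, sub_apply, averaging_apply, S.blockIndex_eq hs, mul_sub]
      rfl
    rw [Finset.sum_congr rfl h, Finset.sum_sub_distrib, ← Finset.sum_mul, S.sum_weight, one_mul,
      ← doubleAvg_eq_sum, sub_self]

end Subdivision

end JamesSpace

/-! ### Uniform smallness of the averages on a weakly compact set. -/

/-- Each functional is weakly continuous, so bounded on `D`; the uniform boundedness principle in
the bidual does the rest. -/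
theorem IsWeaklyCompactSet.exists_norm_le {E : Type*} [NormedAddCommGroup E] [NormedSpace ℝ E]
    {D : Set E} (hD : IsWeaklyCompactSet D) : ∃ R, 0 ≤ R ∧ ∀ x ∈ D, ‖x‖ ≤ R := by
  have h : ∀ f : StrongDual ℝ E, ∃ C, ∀ x : D, ‖NormedSpace.inclusionInDoubleDual ℝ E x f‖ ≤ C := by
    intro f
    have hf : Continuous fun z : WeakSpace ℝ E => f ((toWeakSpace ℝ E).symm z) :=
      WeakBilin.eval_continuous (topDualPairing ℝ E).flip f
    obtain ⟨C, hC⟩ := (hD.image hf).isBounded.exists_norm_le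
    exact ⟨C, fun x => hC _ ⟨toWeakSpace ℝ E x, ⟨x, x.2, rfl⟩, rfl⟩⟩
  obtain ⟨C, hC⟩ := banach_steinhaus h
  refine ⟨max C 0, le_max_right _ _, fun x hx => ?_⟩
  rw [← (NormedSpace.inclusionInDoubleDualLi (E := E) ℝ).norm_map x]
  exact (hC ⟨x, hx⟩).trans (le_max_left _ _)

namespace JamesSpace

/-- The sets of vectors having a coordinate below `δ` in `[N, M)` are weakly open, increase with `M`
and cover `J`, whose elements are null sequences; compactness selects one `M`. -/
theorem exists_uniform_small_coord {D : Set JamesSpace} (hD : IsWeaklyCompactSet D) (N : ℕ) {δ : ℝ}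
    (hδ : 0 < δ) : ∃ M, N < M ∧ ∀ x ∈ D, ∃ s, N ≤ s ∧ s < M ∧ |x s| < δ := by
  have hc : ∀ s, Continuous fun z : WeakSpace ℝ JamesSpace =>
      |((toWeakSpace ℝ JamesSpace).symm z) s| := fun s =>
    (WeakBilin.eval_continuous (topDualPairing ℝ JamesSpace).flip (coord s)).abs
  obtain ⟨M, hM⟩ := hD.elim_directed_cover
    (fun M : ℕ => {z : WeakSpace ℝ JamesSpace |
      ∃ s, N ≤ s ∧ s < M ∧ |((toWeakSpace ℝ JamesSpace).symm z) s| < δ})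
    (fun M => by
      have e : {z : WeakSpace ℝ JamesSpace |
          ∃ s, N ≤ s ∧ s < M ∧ |((toWeakSpace ℝ JamesSpace).symm z) s| < δ}
          = ⋃ s ∈ Set.Ico N M, {z | |((toWeakSpace ℝ JamesSpace).symm z) s| < δ} := by
        ext z
        simp [and_assoc]
      rw [e]
      exact isOpen_biUnion fun s _ => isOpen_lt (hc s) continuous_const)
    (by
      rintro _ ⟨x, -, rfl⟩
      obtain ⟨s, hs1, hs2⟩ := ((eventually_ge_atTop N).and
        (x.tendsto_zero.abs.eventually_lt_const (by simpa using hδ))).exists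
      exact Set.mem_iUnion.2 ⟨s + 1, s, hs1, Nat.lt_succ_self s, hs2⟩)
    (Monotone.directed_le fun M M' h z ⟨s, h1, h2, h3⟩ => ⟨s, h1, lt_of_lt_of_le h2 h, h3⟩)
  -- The maximum secures `N < M` even when `D` is empty.
  refine ⟨max M (N + 1), by omega, fun x hx => ?_⟩
  obtain ⟨s, h1, h2, h3⟩ := hM ⟨x, hx, rfl⟩
  exact ⟨s, h1, by omega, h3⟩

namespace Subdivision

/-- Each interval average is at most `δ` plus the variation `v i` there, and `∑ v i ^ 2 ≤ R ^ 2`.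
Over `k ^ 2` intervals Cauchy-Schwarz gives `∑ v i ≤ k * R`, so the mean of the `v i` is at most `R
/ k ≤ δ`. This is the purpose of the second averaging. -/
theorem abs_doubleAvg_le (S : Subdivision) (j : ℕ) {x : JamesSpace} {R δ : ℝ} {k : ℕ}
    (hx : ‖x‖ ≤ R) (hR : 0 ≤ R)
    (hs : ∀ i, S.p j ≤ i → ∃ s, S.n i ≤ s ∧ s < S.n (i + 1) ∧ |x s| ≤ δ)
    (hk : S.p (j + 1) = S.p j + k ^ 2) (hk1 : 0 < k) (hkR : R ≤ k * δ) :
    |S.doubleAvg j x| ≤ 2 * δ := by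
  set v : ℕ → ℝ := fun i => sqVarNorm ((fun i => x i) ∘ fun l => max (S.n i) (min l (S.n (i + 1))))
  have havg : ∀ i ∈ Finset.Ico (S.p j) (S.p (j + 1)), |avg (S.n i) (S.n (i + 1)) x| ≤ δ + v i := by
    intro i hi
    obtain ⟨s, hs1, hs2, hs3⟩ := hs i (Finset.mem_Ico.1 hi).1
    refine abs_avg_le (S.n_strictMono (Nat.lt_succ_self i)) fun t ht1 ht2 => ?_
    have h := abs_sub_le_sqVarNorm
      (sqVarNorm_comp_le x.bddAbove (monotone_clamp (S.n i) (S.n (i + 1)))).1 s t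
    simp only [Function.comp] at h
    rw [min_eq_left ht2.le, min_eq_left hs2.le, max_eq_right ht1, max_eq_right hs1] at h
    have h1 := abs_add_le (x s) (x t - x s)
    rw [add_sub_cancel] at h1
    exact h1.trans (add_le_add hs3 h)
  have hcard : (Finset.Ico (S.p j) (S.p (j + 1))).card = k ^ 2 := by
    rw [Nat.card_Ico, hk, Nat.add_sub_cancel_left]
  have hv2 : ∑ i ∈ Finset.Ico (S.p j) (S.p (j + 1)), v i ^ 2 ≤ R ^ 2 := by
    have h1 := sum_sqVarNorm_clamp_sq_le x.bddAbove S.n_strictMono.monotone (S.p (j + 1))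
    have h2 : sqVarNorm (fun i => x i) ^ 2 ≤ R ^ 2 := pow_le_pow_left₀ (norm_nonneg x) hx 2
    refine (Finset.sum_le_sum_of_subset_of_nonneg (fun i hi => ?_) fun _ _ _ => sq_nonneg _).trans
      (h1.trans h2)
    exact Finset.mem_range.2 (Finset.mem_Ico.1 hi).2
  have hv : ∑ i ∈ Finset.Ico (S.p j) (S.p (j + 1)), v i ≤ k * R := by
    have h := sq_sum_le_card_mul_sum_sq (s := Finset.Ico (S.p j) (S.p (j + 1))) (f := v)
    rw [hcard] at h
    push_cast at h
    refine le_of_sq_le_sq (h.trans ?_) (by positivity)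
    rw [mul_pow]
    exact mul_le_mul_of_nonneg_left hv2 (by positivity)
  have hk0 : (0 : ℝ) < (k : ℝ) ^ 2 := by positivity
  have e : (S.p (j + 1) : ℝ) - S.p j = (k : ℝ) ^ 2 := by
    rw [hk]
    push_cast
    ring
  rw [doubleAvg, e, abs_div, abs_of_pos hk0, div_le_iff₀ hk0]
  refine ((Finset.abs_sum_le_sum_abs _ _).trans (Finset.sum_le_sum havg)).trans ?_
  rw [Finset.sum_add_distrib, Finset.sum_const, hcard, nsmul_eq_mul]
  push_cast
  nlinarith [mul_le_mul_of_nonneg_left hkR (Nat.cast_nonneg (α := ℝ) k)]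

/-- As `j ≤ p j`, the `j`-th squared jump is at most `4 * δ ^ 2 * (1 / 4) ^ j`. The geometric sum
gives `16 / 3 * δ ^ 2`, below `(3 * δ) ^ 2`. -/
theorem norm_averaging_apply_le_of_doubleAvg (S : Subdivision) {x : JamesSpace} {δ : ℝ}
    (hδ : 0 ≤ δ) (h : ∀ j, |S.doubleAvg j x| ≤ δ * (1 / 2) ^ j) : ‖S.averaging x‖ ≤ 3 * δ := by
  refine (S.norm_averaging_apply_le x).trans (sqVarNorm_le (by positivity) fun n p hp => ?_).2
  have h1 : ∀ j, |S.doubleAvg (p (j + 1)) x - S.doubleAvg (p j) x| ^ 2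
      ≤ 4 * δ ^ 2 * (1 / 4) ^ j := by
    intro j
    have h2 : ∀ k, j ≤ k → |S.doubleAvg k x| ≤ δ * (1 / 2) ^ j := fun k hk =>
      (h k).trans (mul_le_mul_of_nonneg_left
        (pow_le_pow_of_le_one (by norm_num) (by norm_num) hk) hδ)
    have h3 := abs_sub (S.doubleAvg (p (j + 1)) x) (S.doubleAvg (p j) x)
    have h4 := h2 (p (j + 1)) ((Nat.le_succ j).trans hp.le_apply)
    have h5 := h2 (p j) hp.le_apply
    refine (pow_le_pow_left₀ (abs_nonneg _)
      (show _ ≤ 2 * (δ * (1 / 2) ^ j) by linarith) 2).trans_eq ?_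
    rw [mul_pow, mul_pow, ← pow_mul, mul_comm j 2, pow_mul]
    norm_num
    ring
  have h6 : ∑ j ∈ Finset.range n, (1 / 4 : ℝ) ^ j ≤ 4 / 3 := by
    rw [geom_sum_eq (by norm_num), div_le_iff_of_neg (by norm_num)]
    have : (0 : ℝ) ≤ (1 / 4) ^ n := by positivity
    linarith
  refine (Finset.sum_le_sum fun j _ => h1 j).trans ?_
  rw [← Finset.mul_sum]
  nlinarith [sq_nonneg δ]

theorem exists_norm_averaging_le {D : Set JamesSpace} (hD : IsWeaklyCompactSet D) {ε : ℝ}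
    (hε : 0 < ε) : ∃ S : Subdivision, ∀ x ∈ D, ‖S.averaging x‖ ≤ ε := by
  obtain ⟨R, hR, hDR⟩ := hD.exists_norm_le
  -- The `6` is `2 * 3`: the double averages double the threshold and the norm estimate triples it.
  have hδ : ∀ j : ℕ, 0 < ε / 6 * (1 / 2) ^ j := fun j => by positivity
  choose g hg1 hg2 using fun N j => exists_uniform_small_coord hD N (hδ j)
  choose k hk using fun j : ℕ => exists_nat_ge (R / (ε / 6 * (1 / 2) ^ j))
  -- Interval `i` runs from `n i` to `g (n i) i`, so it contains, for every `x ∈ D`, a coordinate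
  -- below the `i`-th threshold. Block `j` gets `(k j + 1) ^ 2` intervals, the `+ 1` keeping it
  -- nonempty.
  let n : ℕ → ℕ := fun i => Nat.rec 0 (fun i ni => g ni i) i
  let S : Subdivision :=
    { n := n
      p := fun j => ∑ l ∈ Finset.range j, (k l + 1) ^ 2
      n_zero := rfl
      p_zero := rfl
      n_strictMono := strictMono_nat_of_lt_succ fun i => hg1 (n i) i
      p_strictMono := strictMono_nat_of_lt_succ fun j => by
        rw [Finset.sum_range_succ]
        exact Nat.lt_add_of_pos_right (by positivity) }
  refine ⟨S, fun x hx => ?_⟩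
  refine (S.norm_averaging_apply_le_of_doubleAvg (δ := ε / 3) (by positivity)
    fun j => ?_).trans_eq (by ring)
  refine (S.abs_doubleAvg_le j (δ := ε / 6 * (1 / 2) ^ j) (k := k j + 1) (hDR x hx) hR
    (fun i hi => ?_) (Finset.sum_range_succ _ _) (Nat.succ_pos _) ?_).trans_eq (by ring)
  · obtain ⟨s, h1, h2, h3⟩ := hg2 (n i) i x hx
    refine ⟨s, h1, h2, h3.le.trans (mul_le_mul_of_nonneg_left ?_ (by positivity))⟩
    -- Intervals of block `j` have number `i ≥ S.p j ≥ j`, so their thresholds are no larger than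
    -- the `j`-th one.
    exact pow_le_pow_of_le_one (by norm_num) (by norm_num) (S.p_strictMono.le_apply.trans hi)
  · rw [← div_le_iff₀ (hδ j)]
    push_cast
    linarith [hk j]

theorem exists_approximating_perturbation {D : Set JamesSpace} (hD : IsWeaklyCompactSet D)
    {ε : ℝ} (hε : 0 < ε) : ∃ S : Subdivision,
      (⨆ x ∈ D, ‖x - (ContinuousLinearMap.id ℝ JamesSpace - S.averaging) x‖ₑ)
        < ENNReal.ofReal ε := by
  -- A pointwise bound only gives `≤` for the supremum; `ε / 2` makes the final inequality strict.
  obtain ⟨S, hS⟩ := exists_norm_averaging_le hD (half_pos hε)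
  refine ⟨S, lt_of_le_of_lt (iSup₂_le fun x hx => ?_)
    ((ENNReal.ofReal_lt_ofReal_iff hε).2 (half_lt_self hε))⟩
  rw [_root_.sub_apply, ContinuousLinearMap.id_apply, sub_sub_cancel,
    ← ofReal_norm]
  exact ENNReal.ofReal_le_ofReal (hS x hx)

end Subdivision

end JamesSpace

/-- James' space `J` has the weakly compact approximation property, with constant `3`.
Moreover, each perturbation of the identity by double averages over consecutive blocks
is a weakly compact operator of norm at most `3`, and for each weakly compact subset of the
unit ball such an operator can be chosen to approximate the identity on it. -/
theorem theorem2p2 :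
    HasWAP JamesSpace ∧ HasWAPWith JamesSpace 3 ∧
    (∀ S : JamesSpace.Subdivision, ∃ V : JamesSpace →L[ℝ] JamesSpace,
      S.IsAveragingPerturbation V ∧ IsWeaklyCompactOperator V ∧ ‖V‖ ≤ 3) ∧
    (∀ D : Set JamesSpace, IsWeaklyCompactSet D → D ⊆ Metric.closedBall 0 1 →
      ∀ ε : ℝ, 0 < ε →
        ∃ (S : JamesSpace.Subdivision) (V : JamesSpace →L[ℝ] JamesSpace),
          S.IsAveragingPerturbation V ∧ IsWeaklyCompactOperator V ∧
          (⨆ x ∈ D, ‖x - V x‖ₑ) < ENNReal.ofReal ε ∧ ‖V‖ ≤ 3) := by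
  have hnorm : ∀ S : JamesSpace.Subdivision,
      ‖ContinuousLinearMap.id ℝ JamesSpace - S.averaging‖ ≤ 3 := fun S =>
    S.norm_id_sub_averaging_le.trans (by norm_num)
  have hW : HasWAPWith JamesSpace 3 := fun D hD ε hε => by
    obtain ⟨S, hS⟩ := JamesSpace.Subdivision.exists_approximating_perturbation hD hε
    exact ⟨_, S.isWeaklyCompactOperator_id_sub_averaging, hS, hnorm S⟩
  refine ⟨⟨3, hW⟩, hW, fun S => ⟨_, S.isAveragingPerturbation,
    S.isWeaklyCompactOperator_id_sub_averaging, hnorm S⟩, fun D hD _ ε hε => ?_⟩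
  obtain ⟨S, hS⟩ := JamesSpace.Subdivision.exists_approximating_perturbation hD hε
  exact ⟨S, _, S.isAveragingPerturbation, S.isWeaklyCompactOperator_id_sub_averaging, hS, hnorm S⟩
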